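/- Work in a universe $V$ of sets satisfying ZFC. Definitions. Let $\theta<\mu$ be (infinite) regular cardinals. A $\theta$-covering matrix for $\mu$ is a family $(K(\alpha,\beta):\alpha<\theta,\ \beta<\mu)$ of subsets of $\mu$ such that (i) $\beta\subseteq\bigcup_{\alpha<\theta}K(\alpha,\beta)$ for all $\beta<\mu$; (ii) $|K(\alpha,\beta)|<\mu$ for all $\alpha<\theta$, $\beta<\mu$; (iii) $K(\alpha,\beta)\subseteq K(\eta,\beta)$ for all $\beta<\mu$ and $\alpha<\eta<\theta$; (iv) for all $\gamma<\beta<\mu$ and $\alpha<\theta$ there is $\eta<\theta$ with $K(\alpha,\gamma)\subseteq K(\eta,\beta)$; (v) for every $X\subseteq\mu$ with $|X|\le\theta$ there is $\gamma_X<\mu$ such that for all $\beta<\mu$ and $\eta<\theta$ there is $\alpha<\theta$ with $K(\eta,\beta)\cap X\subseteq K(\alpha,\gamma_X)$. The covering property $\mathsf{CP}(\mu,\theta)$ says that for every $\theta$-covering matrix for $\mu$ there is an unbounded $A\subseteq\mu$ such that every $X\subseteq A$ with $|X|=\theta$ is contained in some $K(\alpha,\beta)$. An uncountable cardinal $\lambda$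 is strongly compact if for every cardinal $\nu\ge\lambda$ there is a $\lambda$-complete ultrafilter on $[\nu]^{<\lambda}=\{Y\subseteq\nu:|Y|<\lambda\}$ which contains $\{Y:X\subseteq Y\}$ for every $X\in[\nu]^{<\lambda}$. An inner model is a transitive class that contains all ordinals and satisfies ZFC. For an ordinal $\kappa$, $\kappa^+$ denotes the least cardinal of $V$ greater than $\kappa$, and $(\kappa^+)^W$ the least ordinal greater than $\kappa$ that is a cardinal in $W$. Theorem. Let $W$ be an inner model, and let $\kappa$ be an ordinal such that $\kappa$ is a regular cardinal in $W$ and $(\kappa^+)^W=\kappa^+$. (1) If $\theta<\kappa^+$ is a regular cardinal and $\mathsf{CP}(\kappa^+,\theta)$ holds, then $\operatorname{cof}(\kappa)\ne\theta$ in $V$. (2) If $\lambda\le\kappa$ is a cardinal that is strongly compact in $V$, then $\operatorname{cof}(\kappa)\ne\theta$ in $V$ for every cardinal $\theta<\lambda$. In particular, one cannot change the cofinality of a regular $\kappa\ge\lambda$ to some $\theta<\lambda$ while preserving $\kappa^+$ and the strong compactness of $\lambda$. -/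

import Mathlib

universe u

open Cardinal Ordinal

/-! Models of ZFC -/

/-- The symbols of the language of set theory: a single binary relation symbol. -/
inductive MemSymbol : ℕ → Type
  | mem : MemSymbol 2

/-- The first-order language of set theory. -/
def setLang : FirstOrder.Language.{0, 0} := ⟨fun _ => Empty, MemSymbol⟩

/-- A set or class `M` with a binary relation `E`, read as a structure for the language of set
theory. -/
abbrev setStructure {M : Type*} (E : M → M → Prop) : setLang.Structure M where
  funMap := fun f => f.elim
  RelMap := fun {_} r v =>
    match r with
    | MemSymbol.mem => E (v 0) (v 1)

/-- `S ⊆ M` is first-order definable over `(M, E)` with parameters from `M`. -/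
def DefinableClass {M : Type*} (E : M → M → Prop) (S : Set M) : Prop :=
  letI := setStructure E
  (Set.univ : Set M).Definable₁ setLang S

/-- `R ⊆ M × M` is first-order definable over `(M, E)` with parameters from `M`. -/
def DefinableRelation {M : Type*} (E : M → M → Prop) (R : Set (M × M)) : Prop :=
  letI := setStructure E
  (Set.univ : Set M).Definable₂ setLang R

/-- `(M, E)` satisfies the axioms of ZFC. The schemas of separation and replacement range over all
first-order formulas with parameters. -/
structure ModelsZFC {M : Type*} (E : M → M → Prop) : Prop where
  extensionality : ∀ a b, (∀ x, E x a ↔ E x b) → a = b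
  foundation : ∀ a, (∃ x, E x a) → ∃ x, E x a ∧ ∀ y, E y a → ¬ E y x
  pairing : ∀ a b, ∃ c, ∀ x, E x c ↔ x = a ∨ x = b
  union : ∀ a, ∃ u, ∀ x, E x u ↔ ∃ y, E y a ∧ E x y
  powerset : ∀ a, ∃ p, ∀ x, E x p ↔ ∀ z, E z x → E z a
  infinity : ∃ a, (∃ e, E e a ∧ ∀ z, ¬ E z e) ∧
    ∀ x, E x a → ∃ y, E y a ∧ ∀ z, E z y ↔ E z x ∨ z = x
  separation : ∀ S : Set M, DefinableClass E S → ∀ a, ∃ b, ∀ x, E x b ↔ E x a ∧ x ∈ S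
  replacement : ∀ R : Set (M × M), DefinableRelation E R →
    ∀ a, (∀ x, E x a → ∃! y, (x, y) ∈ R) → ∃ b, ∀ y, E y b ↔ ∃ x, E x a ∧ (x, y) ∈ R
  choice : ∀ a, (∀ x, E x a → ∃ z, E z x) →
    (∀ x y, E x a → E y a → x ≠ y → ∀ z, ¬ (E z x ∧ E z y)) →
    ∃ c, ∀ x, E x a → ∃! z, E z x ∧ E z c

/-- `W` is an inner model of the universe `V = ZFSet`: a transitive class that contains all
ordinals and, with the membership relation, satisfies ZFC. -/
structure IsInnerModel (W : Set ZFSet.{u}) : Prop where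
  transitive : ∀ x ∈ W, ∀ y ∈ x, y ∈ W
  ordinals : ∀ α : Ordinal.{u}, α.toZFSet ∈ W
  zfc : ModelsZFC (fun x y : W => (x : ZFSet.{u}) ∈ (y : ZFSet.{u}))

/-- `f` is, as a set of ordered pairs, a bijection from `x` to `y`. -/
def IsBijectionZF (x y f : ZFSet.{u}) : Prop :=
  ZFSet.IsFunc x y f ∧ ∀ w ∈ y, ∃! z, ZFSet.pair z w ∈ f

/-- The ordinal `κ` is a cardinal in `W`: no element of `W` is a bijection between `κ` and a
smaller ordinal. -/
def IsCardinalIn (W : Set ZFSet.{u}) (κ : Ordinal.{u}) : Prop :=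
  ∀ α < κ, ¬ ∃ f ∈ W, IsBijectionZF α.toZFSet κ.toZFSet f

/-- The ordinal `κ` is a regular cardinal in `W`: it is an infinite cardinal in `W`, and no element
of `W` is a function from a smaller ordinal to `κ` with range cofinal in `κ`. -/
def IsRegularIn (W : Set ZFSet.{u}) (κ : Ordinal.{u}) : Prop :=
  ω ≤ κ ∧ IsCardinalIn W κ ∧
    ∀ α < κ, ¬ ∃ f ∈ W, ZFSet.IsFunc α.toZFSet κ.toZFSet f ∧
      ∀ δ < κ, ∃ ξ < α, ∃ η : Ordinal.{u}, δ ≤ η ∧ ZFSet.pair ξ.toZFSet η.toZFSet ∈ f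

/-- `μ` is the cardinal successor of `κ` as computed in `W`. -/
def IsSuccCardinalIn (W : Set ZFSet.{u}) (κ μ : Ordinal.{u}) : Prop :=
  IsLeast {ν : Ordinal.{u} | κ < ν ∧ IsCardinalIn W ν} μ

/-! The covering property -/

/-- `K` is a `θ`-covering matrix for `κ`. The ordinals below `θ` and below `κ` are the elements of
`θ.ord.ToType` and `κ.ord.ToType`; `Set.Iio β` is the ordinal `β` as a subset of `κ`. -/
structure IsCoveringMatrix (κ θ : Cardinal.{u})
    (K : θ.ord.ToType → κ.ord.ToType → Set κ.ord.ToType) : Prop where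
  covers : ∀ β, Set.Iio β ⊆ ⋃ α, K α β
  small : ∀ α β, #(K α β) < κ
  mono : ∀ β α η, α < η → K α β ⊆ K η β
  coherent : ∀ γ β, γ < β → ∀ α, ∃ η, K α γ ⊆ K η β
  locallyCoherent : ∀ X : Set κ.ord.ToType, #X ≤ θ →
    ∃ γ, ∀ β η, ∃ α, K η β ∩ X ⊆ K α γ

/-- The covering property `CP(κ, θ)`: every `θ`-covering matrix for `κ` covers `[A]^θ` for some
unbounded `A ⊆ κ`. -/
def CP (κ θ : Cardinal.{u}) : Prop :=
  ∀ K : θ.ord.ToType → κ.ord.ToType → Set κ.ord.ToType, IsCoveringMatrix κ θ K →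
    ∃ A : Set κ.ord.ToType, IsCofinal A ∧
      ∀ X : Set κ.ord.ToType, X ⊆ A → #X = θ → ∃ α β, X ⊆ K α β

/-- `μ` is strongly compact: it is uncountable, and for every `ν ≥ μ` there is a fine
`μ`-complete ultrafilter on `[ν]^{<μ}`. -/
def IsStronglyCompact (μ : Cardinal.{u}) : Prop :=
  ℵ₀ < μ ∧ ∀ ν : Cardinal.{u}, μ ≤ ν →
    ∃ U : Ultrafilter {Y : Set ν.ord.ToType // #Y < μ},
      CardinalInterFilter (U : Filter {Y : Set ν.ord.ToType // #Y < μ}) μ ∧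
      ∀ X : Set ν.ord.ToType, #X < μ →
        {Y : {Y : Set ν.ord.ToType // #Y < μ} | X ⊆ Y.1} ∈ U

/-!
Suppose that `κ.cof = θ` and `CP(κ⁺, θ)` holds, and let `g : θ → κ` be increasing and cofinal. As `W`
has no cardinal between `κ` and `κ⁺`, for each `β < κ⁺` it contains a bijection `f β` from `κ` onto
`κ + β` (`exists_bijOn_of_isRegularIn`). The sets `K(α, β) = f β [g α]` form a `θ`-covering matrix
for `κ⁺`: both coherence conditions follow from the regularity of `κ` in `W`, which bounds the
function `(f γ)⁻¹ ∘ f β` on `g α` where it is defined (`exists_image_subset_image`). The matrix as a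
whole need not belong to `W`, only each `f β` does.

Let `A` be as in `CP(κ⁺, θ)`, and let `β` bound its first `κ` elements. If no `K(α, β)` contained all
of these, then one missing element for each `α < θ` would give a set of size at most `θ` that is
contained in some `K(α, β')`, and so by coherence in some `K(η, β)`, which is absurd. Hence some
`f β [ν]` with `ν < κ` has order type at least `κ`. But the transitive collapse of `f β [ν]` is in
`W`, by the usual recursion (`IsInnerModel.restrictionMem_collapse`), and composing it with `f β`
gives in `W` a function from `ν` that is unbounded in `κ`. This contradicts the regularity of `κ`
in `W` (`not_strictMonoOn_of_mem_image`).

For the second part, a strongly compact `μ ≤ κ` implies `CP(κ⁺, θ)` for every `θ < μ`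
(`IsStronglyCompact.CP`): a fine `μ`-complete ultrafilter selects for each `γ` one row `α` with
`γ ∈ K(α, β)` for almost all `β`, and unboundedly many `γ` have the same `α`. Moreover `κ` is a limit
ordinal, because it is regular in `W`, so `κ.cof` is a regular cardinal.

The axiom schemas of `W` are applied through `DefinablePred`, a predicate with closure lemmas for
connectives and quantifiers. All functions in `W` that are needed map ordinals to ordinals, and are
handled as functions on `Ordinal` with `RestrictionMem`.
-/

/-! ### Definability over a structure for the language of set theory -/

section Definability

variable {M : Type*} (E : M → M → Prop) {n : ℕ}

/-- The predicate `P` of `n` variables is first-order definable over `(M, E)` with parameters. -/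
def DefinablePred (P : (Fin n → M) → Prop) : Prop :=
  letI := setStructure E
  (Set.univ : Set M).Definable setLang {v | P v}

/-- The terms of the language of set theory with parameters, as functions of `n` variables:
variables and constants. -/
def IsVarOrConst (t : (Fin n → M) → M) : Prop :=
  (∃ i, ∀ v, t v = v i) ∨ ∃ a, ∀ v, t v = a

theorem IsVarOrConst.var (i : Fin n) : IsVarOrConst fun v : Fin n → M => v i :=
  .inl ⟨i, fun _ => rfl⟩

theorem IsVarOrConst.const (a : M) : IsVarOrConst fun _ : Fin n → M => a :=
  .inr ⟨a, fun _ => rfl⟩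

theorem IsVarOrConst.tail {t : (Fin n → M) → M} (ht : IsVarOrConst t) :
    IsVarOrConst fun v : Fin (n + 1) → M => t (Fin.tail v) := by
  rcases ht with ⟨i, hi⟩ | ⟨a, ha⟩
  · exact .inl ⟨i.succ, fun v => hi _⟩
  · exact .inr ⟨a, fun v => ha _⟩

theorem IsVarOrConst.exists_term {t : (Fin n → M) → M} (ht : IsVarOrConst t) :
    letI := setStructure E
    ∃ τ : (setLang.withConstants (Set.univ : Set M)).Term (Fin n), ∀ v, τ.realize v = t v := by
  let := setStructure E
  rcases ht with ⟨i, hi⟩ | ⟨a, ha⟩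
  · exact ⟨.var i, fun v => (hi v).symm⟩
  · exact ⟨FirstOrder.Language.Constants.term (setLang.con (⟨a, trivial⟩ : (Set.univ : Set M))),
      fun v => by simp [ha v]⟩

namespace DefinablePred

variable {E} {P Q : (Fin n → M) → Prop} {s t : (Fin n → M) → M}

theorem mem (ht : IsVarOrConst t) (hs : IsVarOrConst s) :
    DefinablePred E fun v => E (t v) (s v) := by
  let := setStructure E
  obtain ⟨τ, hτ⟩ := ht.exists_term E
  obtain ⟨σ, hσ⟩ := hs.exists_term E
  let r : (setLang.withConstants (Set.univ : Set M)).Relations 2 := Sum.inl MemSymbol.mem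
  refine ⟨r.formula₂ τ σ, ?_⟩
  ext v
  have h := FirstOrder.Language.Formula.realize_rel₂ (R := r) (t₁ := τ) (t₂ := σ) (v := v)
  rw [hτ, hσ] at h
  exact h.symm

theorem eq (ht : IsVarOrConst t) (hs : IsVarOrConst s) :
    DefinablePred E fun v => t v = s v := by
  let := setStructure E
  obtain ⟨τ, hτ⟩ := ht.exists_term E
  obtain ⟨σ, hσ⟩ := hs.exists_term E
  exact ⟨τ.equal σ, by ext v; simp [hτ, hσ]⟩

theorem and (hP : DefinablePred E P) (hQ : DefinablePred E Q) :
    DefinablePred E fun v => P v ∧ Q v :=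
  let := setStructure E
  Set.Definable.inter hP hQ

theorem or (hP : DefinablePred E P) (hQ : DefinablePred E Q) :
    DefinablePred E fun v => P v ∨ Q v :=
  let := setStructure E
  Set.Definable.union hP hQ

theorem not (hP : DefinablePred E P) : DefinablePred E fun v => ¬ P v :=
  let := setStructure E
  Set.Definable.compl hP

theorem imp (hP : DefinablePred E P) (hQ : DefinablePred E Q) :
    DefinablePred E fun v => P v → Q v := by
  simpa only [imp_iff_not_or] using hP.not.or hQ

theorem iff (hP : DefinablePred E P) (hQ : DefinablePred E Q) :
    DefinablePred E fun v => P v ↔ Q v := by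
  simpa only [iff_def] using (hP.imp hQ).and (hQ.imp hP)

/-- In the hypothesis the quantified variable is the variable `0`, and the other variables are
shifted by one. -/
theorem ex {R : M → (Fin n → M) → Prop}
    (hR : DefinablePred E fun v : Fin (n + 1) → M => R (v 0) (Fin.tail v)) :
    DefinablePred E fun v => ∃ x, R x v := by
  let := setStructure E
  have h := Set.Definable.image_comp hR (Fin.succ : Fin n → Fin (n + 1))
  suffices {v | ∃ x, R x v} = (fun w : Fin (n + 1) → M => w ∘ Fin.succ) ''
      {w | R (w 0) (Fin.tail w)} by
    rw [DefinablePred, this]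
    exact h
  ext v
  constructor
  · rintro ⟨x, hx⟩
    exact ⟨Fin.cons x v, by simpa using hx, by ext i; simp⟩
  · rintro ⟨w, hw, rfl⟩
    exact ⟨w 0, hw⟩

theorem all {R : M → (Fin n → M) → Prop}
    (hR : DefinablePred E fun v : Fin (n + 1) → M => R (v 0) (Fin.tail v)) :
    DefinablePred E fun v => ∀ x, R x v := by
  simpa only [not_exists, not_not] using (ex (R := fun x v => ¬ R x v) hR.not).not

/-- `r v` is the unordered pair of `t v` and `s v` in the sense of `E`. -/
theorem isUnorderedPair {r : (Fin n → M) → M} (ht : IsVarOrConst t) (hs : IsVarOrConst s)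
    (hr : IsVarOrConst r) :
    DefinablePred E fun v => ∀ x, E x (r v) ↔ x = t v ∨ x = s v :=
  all (R := fun x v => E x (r v) ↔ x = t v ∨ x = s v)
    ((mem (.var 0) hr.tail).iff ((eq (.var 0) ht.tail).or (eq (.var 0) hs.tail)))

end DefinablePred

end Definability

/-! ### Inner models -/

section InnerModel

variable {W : Set ZFSet.{u}}

/-- First-order definability, with parameters, over `(W, ∈)`. -/
abbrev DefinableOver (W : Set ZFSet.{u}) {n : ℕ} (P : (Fin n → W) → Prop) : Prop :=
  DefinablePred (fun x y : W => (x : ZFSet.{u}) ∈ (y : ZFSet.{u})) P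

namespace IsInnerModel

variable (hW : IsInnerModel W)
include hW

theorem unorderedPair_mem {x y : ZFSet.{u}} (hx : x ∈ W) (hy : y ∈ W) :
    ({x, y} : ZFSet.{u}) ∈ W := by
  obtain ⟨c, hc⟩ := hW.zfc.pairing ⟨x, hx⟩ ⟨y, hy⟩
  convert c.2
  ext z
  rw [ZFSet.mem_pair]
  constructor
  · rintro (rfl | rfl)
    · exact (hc ⟨_, hx⟩).2 (.inl rfl)
    · exact (hc ⟨_, hy⟩).2 (.inr rfl)
  · intro hz
    simpa [Subtype.ext_iff] using (hc ⟨z, hW.transitive _ c.2 _ hz⟩).1 hz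

theorem pair_mem {x y : ZFSet.{u}} (hx : x ∈ W) (hy : y ∈ W) : ZFSet.pair x y ∈ W := by
  have h := hW.unorderedPair_mem hx hx
  rw [ZFSet.pair_eq_singleton] at h
  exact hW.unorderedPair_mem h (hW.unorderedPair_mem hx hy)

theorem eq_unorderedPair_iff {a b c : W} :
    (c : ZFSet.{u}) = {(a : ZFSet.{u}), (b : ZFSet.{u})} ↔
      ∀ x : W, (x : ZFSet.{u}) ∈ (c : ZFSet.{u}) ↔ x = a ∨ x = b := by
  constructor
  · intro h x
    simp [h, Subtype.ext_iff]
  · intro h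
    ext z
    rw [ZFSet.mem_pair]
    constructor
    · intro hz
      simpa [Subtype.ext_iff] using (h ⟨z, hW.transitive _ c.2 _ hz⟩).1 hz
    · rintro (rfl | rfl)
      · exact (h a).2 (.inl rfl)
      · exact (h b).2 (.inr rfl)

/-- The relation `r = (t, s)` of Kuratowski pairs is definable over an inner model. -/
theorem definable_eq_pair {n : ℕ} {r s t : (Fin n → W) → W} (hr : IsVarOrConst r)
    (ht : IsVarOrConst t) (hs : IsVarOrConst s) :
    DefinableOver W fun v => (r v : ZFSet.{u}) = ZFSet.pair (t v) (s v) := by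
  have key : ∀ a b c : W, (c : ZFSet.{u}) = ZFSet.pair a b ↔
      ∃ p q : W, (∀ x : W, (x : ZFSet.{u}) ∈ (p : ZFSet.{u}) ↔ x = a ∨ x = a) ∧
        (∀ x : W, (x : ZFSet.{u}) ∈ (q : ZFSet.{u}) ↔ x = a ∨ x = b) ∧
        (∀ x : W, (x : ZFSet.{u}) ∈ (c : ZFSet.{u}) ↔ x = p ∨ x = q) := by
    intro a b c
    simp only [← hW.eq_unorderedPair_iff, ZFSet.pair_eq_singleton]
    constructor
    · intro h
      refine ⟨⟨{(a : ZFSet.{u})}, ?_⟩, ⟨{(a : ZFSet.{u}), (b : ZFSet.{u})}, ?_⟩, rfl, rfl, h⟩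
      · simpa using hW.unorderedPair_mem a.2 a.2
      · exact hW.unorderedPair_mem a.2 b.2
    · rintro ⟨p, q, hp, hq, h⟩
      rw [h, hp, hq]; rfl
  simp only [key]
  refine .ex (.ex (.and ?_ (.and ?_ ?_)))
  · exact .isUnorderedPair ht.tail.tail ht.tail.tail (.inl ⟨1, fun _ => rfl⟩)
  · exact .isUnorderedPair ht.tail.tail hs.tail.tail (.var 0)
  · exact .isUnorderedPair (.inl ⟨1, fun _ => rfl⟩) (.var 0) hr.tail.tail

theorem definable_pair_mem {n : ℕ} {r s t : (Fin n → W) → W} (ht : IsVarOrConst t)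
    (hs : IsVarOrConst s) (hr : IsVarOrConst r) :
    DefinableOver W fun v => ZFSet.pair (t v) (s v) ∈ (r v : ZFSet.{u}) := by
  have key : ∀ a b c : W, ZFSet.pair a b ∈ (c : ZFSet.{u}) ↔
      ∃ p : W, (p : ZFSet.{u}) = ZFSet.pair a b ∧ (p : ZFSet.{u}) ∈ (c : ZFSet.{u}) := by
    intro a b c
    constructor
    · exact fun h => ⟨⟨_, hW.pair_mem a.2 b.2⟩, rfl, h⟩
    · rintro ⟨p, hp, h⟩
      rwa [← hp]
  simp only [key]
  exact .ex (.and (hW.definable_eq_pair (.var 0) ht.tail hs.tail) (.mem (.var 0) hr.tail))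

/-- Replacement in an inner model, for the graph of a definable function. -/
theorem exists_graph {a : ZFSet.{u}} (ha : a ∈ W) (R : W → W → Prop)
    (hR : DefinableOver W fun v : Fin 2 → W => R (v 0) (v 1))
    (hfun : ∀ x : W, (x : ZFSet.{u}) ∈ a → ∃! y, R x y) :
    ∃ g ∈ W, ∀ z, z ∈ g ↔ ∃ x y : W, (x : ZFSet.{u}) ∈ a ∧ R x y ∧ z = ZFSet.pair x y := by
  let S : Set (W × W) := {p | ∃ y, R p.1 y ∧ (p.2 : ZFSet.{u}) = ZFSet.pair p.1 y}
  have hS : DefinableRelation (fun x y : W => (x : ZFSet.{u}) ∈ (y : ZFSet.{u})) S := by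
    have h : DefinableOver W fun v : Fin 2 → W =>
        ∃ y, R (v 0) y ∧ (v 1 : ZFSet.{u}) = ZFSet.pair (v 0) y := by
      refine .ex (.and ?_ (hW.definable_eq_pair (.inl ⟨2, fun _ => rfl⟩) (.inl ⟨1, fun _ => rfl⟩)
        (.var 0)))
      let := setStructure fun x y : W => (x : ZFSet.{u}) ∈ (y : ZFSet.{u})
      exact Set.Definable.preimage_comp (![1, 0] : Fin 2 → Fin 3) hR
    exact h
  obtain ⟨b, hb⟩ := hW.zfc.replacement S hS ⟨a, ha⟩ (by
    intro x hx
    obtain ⟨y, hy, huniq⟩ := hfun x hx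
    refine ⟨⟨_, hW.pair_mem x.2 y.2⟩, ⟨y, hy, rfl⟩, ?_⟩
    rintro p ⟨y', hy', hp⟩
    rw [Subtype.ext_iff, hp, huniq y' hy'])
  refine ⟨b, b.2, fun z => ⟨fun hz => ?_, ?_⟩⟩
  · obtain ⟨x, hx, y, hy, h⟩ := (hb ⟨z, hW.transitive _ b.2 _ hz⟩).1 hz
    exact ⟨x, y, hx, hy, h⟩
  · rintro ⟨x, y, hx, hy, rfl⟩
    exact (hb ⟨_, hW.pair_mem x.2 y.2⟩).2 ⟨x, hx, y, hy, rfl⟩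

end IsInnerModel

/-! ### Functions on ordinals in an inner model -/

/-- The restriction of `F` to the ordinal `ν`, as a set of ordered pairs, belongs to `W`. Values of
`F` at ordinals `ξ ≥ ν` are irrelevant. -/
def RestrictionMem (W : Set ZFSet.{u}) (ν : Ordinal.{u}) (F : Ordinal.{u} → Ordinal.{u}) : Prop :=
  ∃ g ∈ W, ∀ z, z ∈ g ↔ ∃ ξ < ν, z = ZFSet.pair ξ.toZFSet (F ξ).toZFSet

theorem pair_mem_graph_iff {ν : Ordinal.{u}} {F : Ordinal.{u} → Ordinal.{u}} {g : ZFSet.{u}}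
    (hg : ∀ z, z ∈ g ↔ ∃ ξ < ν, z = ZFSet.pair ξ.toZFSet (F ξ).toZFSet) {x y : ZFSet.{u}} :
    ZFSet.pair x y ∈ g ↔ ∃ ξ < ν, x = ξ.toZFSet ∧ y = (F ξ).toZFSet := by
  simp [hg, ZFSet.pair_inj]

theorem pair_toZFSet_mem_graph_iff {ν : Ordinal.{u}} {F : Ordinal.{u} → Ordinal.{u}}
    {g : ZFSet.{u}} (hg : ∀ z, z ∈ g ↔ ∃ ξ < ν, z = ZFSet.pair ξ.toZFSet (F ξ).toZFSet)
    {ξ : Ordinal.{u}} {y : ZFSet.{u}} :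
    ZFSet.pair ξ.toZFSet y ∈ g ↔ ξ < ν ∧ y = (F ξ).toZFSet := by
  simp [hg, ZFSet.pair_inj, Ordinal.toZFSet_injective.eq_iff]

theorem RestrictionMem.exists_isFunc {ν κ : Ordinal.{u}} {F : Ordinal.{u} → Ordinal.{u}}
    (hF : RestrictionMem W ν F) (hκ : ∀ ξ < ν, F ξ < κ) :
    ∃ g ∈ W, ZFSet.IsFunc ν.toZFSet κ.toZFSet g ∧
      ∀ ξ < ν, ZFSet.pair ξ.toZFSet (F ξ).toZFSet ∈ g := by
  obtain ⟨g, hgW, hg⟩ := hF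
  refine ⟨g, hgW, ⟨fun z hz => ?_, fun z hz => ?_⟩, fun ξ hξ => (hg _).2 ⟨ξ, hξ, rfl⟩⟩
  · obtain ⟨ξ, hξ, rfl⟩ := (hg z).1 hz
    simpa [hξ] using hκ ξ hξ
  · obtain ⟨ξ, hξ, rfl⟩ := Ordinal.mem_toZFSet_iff.1 hz
    exact ⟨(F ξ).toZFSet, (hg _).2 ⟨ξ, hξ, rfl⟩, fun y hy => ((pair_toZFSet_mem_graph_iff hg).1 hy).2⟩

theorem RestrictionMem.congr {ν : Ordinal.{u}} {F G : Ordinal.{u} → Ordinal.{u}}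
    (hF : RestrictionMem W ν F) (h : ∀ ξ < ν, F ξ = G ξ) : RestrictionMem W ν G := by
  obtain ⟨g, hgW, hg⟩ := hF
  refine ⟨g, hgW, fun z => (hg z).trans ?_⟩
  exact exists_congr fun ξ => and_congr_right fun hξ => by rw [h ξ hξ]

/-- A bijection between ordinals in the sense of `ZFSet`, as a function on `Ordinal`. -/
theorem IsBijectionZF.exists_bijOn {α β : Ordinal.{u}} {f : ZFSet.{u}} (hfW : f ∈ W)
    (hf : IsBijectionZF α.toZFSet β.toZFSet f) :
    ∃ F : Ordinal.{u} → Ordinal.{u}, RestrictionMem W α F ∧ Set.BijOn F (Set.Iio α) (Set.Iio β) := by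
  obtain ⟨⟨hsub, hfun⟩, hbij⟩ := hf
  have h : ∀ ξ : Ordinal.{u}, ∃ η : Ordinal.{u}, ξ < α →
      η < β ∧ ZFSet.pair ξ.toZFSet η.toZFSet ∈ f := by
    intro ξ
    by_cases hξ : ξ < α
    · obtain ⟨w, hw, -⟩ := hfun ξ.toZFSet (Ordinal.toZFSet_mem_toZFSet_iff.2 hξ)
      obtain ⟨η, hη, rfl⟩ := Ordinal.mem_toZFSet_iff.1 (ZFSet.pair_mem_prod.1 (hsub hw)).2
      exact ⟨η, fun _ => ⟨hη, hw⟩⟩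
    · exact ⟨0, fun h => (hξ h).elim⟩
  choose F hF using h
  have huniq : ∀ ξ < α, ∀ y, ZFSet.pair ξ.toZFSet y ∈ f → y = (F ξ).toZFSet := fun ξ hξ y hy =>
    (hfun ξ.toZFSet (Ordinal.toZFSet_mem_toZFSet_iff.2 hξ)).unique hy (hF ξ hξ).2
  refine ⟨F, ⟨f, hfW, fun z => ⟨fun hz => ?_, ?_⟩⟩, fun ξ hξ => (hF ξ hξ).1, ?_, ?_⟩
  · obtain ⟨a, ha, b, hb, rfl⟩ := ZFSet.mem_prod.1 (hsub hz)
    obtain ⟨ξ, hξ, rfl⟩ := Ordinal.mem_toZFSet_iff.1 ha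
    exact ⟨ξ, hξ, by rw [huniq ξ hξ b hz]⟩
  · rintro ⟨ξ, hξ, rfl⟩
    exact (hF ξ hξ).2
  · intro ξ hξ ζ hζ h
    have h2 := (hF ζ hζ).2
    rw [← h] at h2
    exact Ordinal.toZFSet_injective ((hbij (F ξ).toZFSet
      (Ordinal.toZFSet_mem_toZFSet_iff.2 (hF ξ hξ).1)).unique (hF ξ hξ).2 h2)
  · intro η hη
    obtain ⟨z, hz, -⟩ := hbij η.toZFSet (Ordinal.toZFSet_mem_toZFSet_iff.2 hη)
    obtain ⟨ξ, hξ, rfl⟩ := Ordinal.mem_toZFSet_iff.1 (ZFSet.pair_mem_prod.1 (hsub hz)).1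
    exact ⟨ξ, hξ, (Ordinal.toZFSet_injective (huniq ξ hξ _ hz)).symm⟩

/-- Regularity in `W`: a function in `W` from an ordinal below `κ` to `κ` is bounded. -/
theorem IsRegularIn.exists_bound {κ ν : Ordinal.{u}} (hκ : IsRegularIn W κ) {F : Ordinal.{u} → Ordinal.{u}}
    (hν : ν < κ) (hF : RestrictionMem W ν F) (hFκ : ∀ ξ < ν, F ξ < κ) :
    ∃ δ < κ, ∀ ξ < ν, F ξ < δ := by
  obtain ⟨g, hgW, hg, hgF⟩ := hF.exists_isFunc hFκ
  by_contra! h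
  refine hκ.2.2 ν hν ⟨g, hgW, hg, fun δ hδ => ?_⟩
  obtain ⟨ξ, hξ, hle⟩ := h δ hδ
  exact ⟨ξ, hξ, F ξ, hle, hgF ξ hξ⟩

namespace IsInnerModel

variable (hW : IsInnerModel W)
include hW

/-- A function on ordinals whose restriction to `ν` is definable over `W` has this restriction
in `W`. -/
theorem restrictionMem_of_definable {ν : Ordinal.{u}} {F : Ordinal.{u} → Ordinal.{u}}
    (R : W → W → Prop) (hR : DefinableOver W fun v : Fin 2 → W => R (v 0) (v 1))
    (hF : ∀ ξ < ν, ∀ y : W, R ⟨ξ.toZFSet, hW.ordinals ξ⟩ y ↔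
      (y : ZFSet.{u}) = (F ξ).toZFSet) :
    RestrictionMem W ν F := by
  obtain ⟨g, hgW, hg⟩ := hW.exists_graph (hW.ordinals ν) R hR (by
    rintro ⟨x, hx⟩ hxν
    obtain ⟨ξ, hξ, rfl⟩ := Ordinal.mem_toZFSet_iff.1 hxν
    exact ⟨⟨(F ξ).toZFSet, hW.ordinals _⟩, (hF ξ hξ _).2 rfl,
      fun y hy => Subtype.ext ((hF ξ hξ y).1 hy)⟩)
  refine ⟨g, hgW, fun z => (hg z).trans ⟨?_, ?_⟩⟩
  · rintro ⟨⟨x, hx⟩, y, hxν, hxy, rfl⟩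
    obtain ⟨ξ, hξ, rfl⟩ := Ordinal.mem_toZFSet_iff.1 hxν
    exact ⟨ξ, hξ, by rw [(hF ξ hξ y).1 hxy]⟩
  · rintro ⟨ξ, hξ, rfl⟩
    exact ⟨⟨_, hW.ordinals ξ⟩, ⟨_, hW.ordinals _⟩, Ordinal.toZFSet_mem_toZFSet_iff.2 hξ,
      (hF ξ hξ _).2 rfl, rfl⟩

theorem restrictionMem_id (ν : Ordinal.{u}) : RestrictionMem W ν id :=
  hW.restrictionMem_of_definable (fun x y => y = x) (.eq (.var 1) (.var 0))
    fun _ _ _ => Subtype.ext_iff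

theorem restrictionMem_const (ν γ : Ordinal.{u}) : RestrictionMem W ν fun _ => γ :=
  hW.restrictionMem_of_definable (fun _ y => y = ⟨γ.toZFSet, hW.ordinals γ⟩)
    (.eq (.var 1) (.const _)) fun _ _ _ => Subtype.ext_iff

/-- Composition in an inner model, truncated to `0` where the inner function leaves the domain of
the outer one. -/
theorem restrictionMem_comp {ν β : Ordinal.{u}} {F G : Ordinal.{u} → Ordinal.{u}}
    (hF : RestrictionMem W ν F) (hG : RestrictionMem W β G) :
    RestrictionMem W ν fun ξ => if F ξ < β then G (F ξ) else 0 := by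
  obtain ⟨f, hfW, hf⟩ := hF
  obtain ⟨g, hgW, hg⟩ := hG
  refine hW.restrictionMem_of_definable (fun x y => ∃ z : W, ZFSet.pair x z ∈ f ∧
    (ZFSet.pair z y ∈ g ∨ (¬ (z : ZFSet.{u}) ∈ β.toZFSet ∧
      y = ⟨(0 : Ordinal.{u}).toZFSet, hW.ordinals 0⟩))) ?_ ?_
  · refine .ex (.and ?_ (.or ?_ (.and (.not ?_) ?_)))
    · exact hW.definable_pair_mem (n := 3) (.inl ⟨1, fun _ => rfl⟩) (.var 0) (.const ⟨f, hfW⟩)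
    · exact hW.definable_pair_mem (n := 3) (.var 0) (.inl ⟨2, fun _ => rfl⟩) (.const ⟨g, hgW⟩)
    · exact .mem (.var 0) (.const (⟨_, hW.ordinals β⟩ : W))
    · exact .eq (.inl ⟨2, fun _ => rfl⟩) (.const _)
  · intro ξ hξ y
    have h : ∀ z : W, ZFSet.pair ξ.toZFSet z ∈ f ↔ z = ⟨(F ξ).toZFSet, hW.ordinals _⟩ := fun z => by
      simp [pair_toZFSet_mem_graph_iff hf, hξ, Subtype.ext_iff]
    simp only [h, exists_eq_left, pair_toZFSet_mem_graph_iff hg,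
      Ordinal.toZFSet_mem_toZFSet_iff]
    rw [Subtype.ext_iff]
    split_ifs with hβ <;> simp [hβ]

theorem restrictionMem_invFunOn {α β : Ordinal.{u}} {F : Ordinal.{u} → Ordinal.{u}}
    (hF : RestrictionMem W α F) (hbij : Set.BijOn F (Set.Iio α) (Set.Iio β)) :
    RestrictionMem W β (Function.invFunOn F (Set.Iio α)) := by
  obtain ⟨f, hfW, hf⟩ := hF
  refine hW.restrictionMem_of_definable (fun x y => ZFSet.pair y x ∈ f)
    (hW.definable_pair_mem (.var 1) (.var 0) (.const ⟨f, hfW⟩)) fun ξ hξ y => ?_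
  have h1 := hbij.surjOn hξ
  have h2 := Function.invFunOn_mem h1
  have h3 := Function.invFunOn_eq h1
  rw [pair_mem_graph_iff hf]
  constructor
  · rintro ⟨η, hη, hy, hξη⟩
    rw [hy, Ordinal.toZFSet_injective.eq_iff]
    exact hbij.injOn hη h2 ((Ordinal.toZFSet_injective hξη).symm.trans h3.symm)
  · exact fun hy => ⟨_, h2, hy, by rw [h3]⟩

end IsInnerModel

/-! ### The collapse of a set of ordinals -/

/-- The transitive collapse of the set `S` of ordinals, extended to all ordinals: `collapse S s` is
the order type of `S ∩ s`. It is the least ordinal that is not a value at an element of `S ∩ s`. -/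
noncomputable def collapse (S : Set Ordinal.{u}) (s : Ordinal.{u}) : Ordinal.{u} :=
  sInf {o | ∀ s' (_ : s' < s), s' ∈ S → collapse S s' ≠ o}
termination_by s

theorem lt_collapse_iff {S : Set Ordinal.{u}} {s o : Ordinal.{u}} :
    o < collapse S s ↔ ∃ s' ∈ S, s' < s ∧ collapse S s' = o := by
  have down : ∀ {s o}, o < collapse S s → ∃ s' ∈ S, s' < s ∧ collapse S s' = o := by
    intro s o h
    rw [collapse] at h
    have := notMem_of_lt_csInf' h
    simp only [Set.mem_ofPred_eq, not_forall, not_not] at this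
    obtain ⟨s', h1, h2, h3⟩ := this
    exact ⟨s', h2, h1, h3⟩
  refine ⟨down, ?_⟩
  rintro ⟨s', hs', hlt, rfl⟩
  have hmex : ∀ t < s, t ∈ S → collapse S t ≠ collapse S s := by
    have hne : {o | ∀ s' (_ : s' < s), s' ∈ S → collapse S s' ≠ o}.Nonempty := by
      obtain ⟨b, hb⟩ := Ordinal.bddAbove_of_small (s := collapse S '' Set.Iio s)
      refine ⟨Order.succ b, fun t ht _ h => ?_⟩
      exact (Order.lt_succ b).not_ge (h ▸ hb ⟨t, ht, rfl⟩)
    have := csInf_mem hne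
    intro t ht htS
    conv_rhs => rw [collapse]
    exact this t ht htS
  refine lt_of_le_of_ne ?_ (hmex s' hlt hs')
  by_contra! h
  obtain ⟨t, htS, ht, heq⟩ := down h
  exact hmex t (ht.trans hlt) htS heq

theorem collapse_lt_collapse {S : Set Ordinal.{u}} {s t : Ordinal.{u}} (hs : s ∈ S) (hst : s < t) :
    collapse S s < collapse S t :=
  lt_collapse_iff.2 ⟨s, hs, hst, rfl⟩

/-- An increasing function into `S` lies below the collapse of its values. -/
theorem le_collapse_of_strictMonoOn {S : Set Ordinal.{u}} {κ : Ordinal.{u}}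
    {h : Ordinal.{u} → Ordinal.{u}} (hmono : StrictMonoOn h (Set.Iio κ))
    (hS : ∀ δ < κ, h δ ∈ S) (δ : Ordinal.{u}) (hδ : δ < κ) : δ ≤ collapse S (h δ) := by
  induction δ using WellFoundedLT.induction with
  | ind δ ih =>
    by_contra! hlt
    have hlt' := hlt.trans hδ
    exact (ih _ hlt hlt').not_gt (collapse_lt_collapse (hS _ hlt') (hmono hlt' hδ hlt))

/-- The collapse of a set in an inner model belongs to the inner model. -/
theorem IsInnerModel.restrictionMem_collapse (hW : IsInnerModel W) {ν : Ordinal.{u}}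
    {F : Ordinal.{u} → Ordinal.{u}} (hF : RestrictionMem W ν F) (β : Ordinal.{u}) :
    RestrictionMem W β (collapse (F '' Set.Iio ν)) := by
  set S := F '' Set.Iio ν with hS
  obtain ⟨f, hfW, hf⟩ := hF
  have hmemS : ∀ y : W, (∃ x : W, ZFSet.pair x y ∈ f) ↔ ∃ s ∈ S, (y : ZFSet.{u}) = s.toZFSet := by
    intro y
    constructor
    · rintro ⟨x, hx⟩
      obtain ⟨ξ, hξ, -, hy⟩ := (pair_mem_graph_iff hf).1 hx
      exact ⟨F ξ, ⟨ξ, hξ, rfl⟩, hy⟩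
    · rintro ⟨s, ⟨ξ, hξ, rfl⟩, hy⟩
      exact ⟨⟨_, hW.ordinals ξ⟩, (pair_toZFSet_mem_graph_iff hf).2 ⟨hξ, hy⟩⟩
  -- `T e s o` says that `o` is the set of the values of `e` on `S ∩ s`.
  let T : W → W → W → Prop := fun e s o => ∀ p : W, (p : ZFSet.{u}) ∈ (o : ZFSet.{u}) ↔
    ∃ s' : W, (∃ x : W, ZFSet.pair x s' ∈ f) ∧ (s' : ZFSet.{u}) ∈ (s : ZFSet.{u}) ∧
      ZFSet.pair s' p ∈ (e : ZFSet.{u})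
  -- `A e s` says that `e` satisfies the recursion of the collapse below `s`.
  let A : W → W → Prop := fun e s => ∀ t : W, (t : ZFSet.{u}) ∈ (s : ZFSet.{u}) →
    ∀ o : W, ZFSet.pair t o ∈ (e : ZFSet.{u}) ↔ T e t o
  have hT : ∀ {n : ℕ} {a b c : (Fin n → W) → W}, IsVarOrConst a → IsVarOrConst b →
      IsVarOrConst c → DefinableOver W fun v => T (a v) (b v) (c v) := by
    intro n a b c ha hb hc
    refine .all (.iff (.mem (.var 0) hc.tail) (.ex (.and (.ex ?_) (.and ?_ ?_))))
    · exact hW.definable_pair_mem (n := n + 3) (.var 0) (.inl ⟨1, fun _ => rfl⟩) (.const ⟨f, hfW⟩)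
    · exact .mem (.var 0) hb.tail.tail
    · exact hW.definable_pair_mem (.var 0) (.inl ⟨1, fun _ => rfl⟩) ha.tail.tail
  have hA : ∀ {n : ℕ} {a b : (Fin n → W) → W}, IsVarOrConst a → IsVarOrConst b →
      DefinableOver W fun v => A (a v) (b v) := by
    intro n a b ha hb
    refine .all (.imp (.mem (.var 0) hb.tail) (.all (.iff ?_ ?_)))
    · exact hW.definable_pair_mem (.inl ⟨1, fun _ => rfl⟩) (.var 0) ha.tail.tail
    · exact hT ha.tail.tail (.inl ⟨1, fun _ => rfl⟩) (.var 0)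
  let R : W → W → Prop := fun s o => ∃ e : W, A e s ∧ T e s o
  have hR : DefinableOver W fun v : Fin 2 → W => R (v 0) (v 1) :=
    .ex (.and (hA (n := 3) (.var 0) (.inl ⟨1, fun _ => rfl⟩))
      (hT (n := 3) (.var 0) (.inl ⟨1, fun _ => rfl⟩) (.inl ⟨2, fun _ => rfl⟩)))
  -- If `e` is correct below `s`, then `T e s` defines the collapse of `s`.
  have hTval : ∀ (e : W) (s : Ordinal.{u}), (∀ t < s, t ∈ S → ∀ p : W,
      ZFSet.pair t.toZFSet p ∈ (e : ZFSet.{u}) ↔ (p : ZFSet.{u}) = (collapse S t).toZFSet) →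
      ∀ o : W, T e ⟨_, hW.ordinals s⟩ o ↔ (o : ZFSet.{u}) = (collapse S s).toZFSet := by
    intro e s he o
    have hval : ∀ p : W, (∃ s' : W, (∃ x : W, ZFSet.pair x s' ∈ f) ∧
        (s' : ZFSet.{u}) ∈ s.toZFSet ∧ ZFSet.pair s' p ∈ (e : ZFSet.{u})) ↔
        (p : ZFSet.{u}) ∈ (collapse S s).toZFSet := by
      intro p
      rw [Ordinal.mem_toZFSet_iff]
      constructor
      · rintro ⟨s', hs', hlt, hp⟩
        obtain ⟨t, htS, ht⟩ := (hmemS s').1 hs'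
        rw [ht] at hlt hp
        have hlt := Ordinal.toZFSet_mem_toZFSet_iff.1 hlt
        exact ⟨_, collapse_lt_collapse htS hlt, ((he t hlt htS p).1 hp).symm⟩
      · rintro ⟨q, hq, hqp⟩
        obtain ⟨t, htS, ht, rfl⟩ := lt_collapse_iff.1 hq
        exact ⟨⟨_, hW.ordinals t⟩, (hmemS _).2 ⟨t, htS, rfl⟩,
          Ordinal.toZFSet_mem_toZFSet_iff.2 ht, (he t ht htS p).2 hqp.symm⟩
    constructor
    · intro h
      ext z
      constructor
      · intro hz
        have hzW := hW.transitive _ o.2 _ hz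
        exact (hval ⟨z, hzW⟩).1 ((h ⟨z, hzW⟩).1 hz)
      · intro hz
        have hzW := hW.transitive _ (hW.ordinals _) _ hz
        exact (h ⟨z, hzW⟩).2 ((hval ⟨z, hzW⟩).2 hz)
    · intro h p
      rw [h]
      exact (hval p).symm
  -- If `e` satisfies the recursion below `s`, then `e` is correct below `s`.
  have hAval : ∀ (e : W) (s : Ordinal.{u}), A e ⟨_, hW.ordinals s⟩ → ∀ t < s, ∀ p : W,
      ZFSet.pair t.toZFSet p ∈ (e : ZFSet.{u}) ↔ (p : ZFSet.{u}) = (collapse S t).toZFSet := by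
    intro e s he t
    induction t using WellFoundedLT.induction with
    | ind t ih =>
      intro hts p
      rw [← hTval e t (fun t' ht' _ => ih t' ht' (ht'.trans hts))]
      exact he ⟨_, hW.ordinals t⟩ (Ordinal.toZFSet_mem_toZFSet_iff.2 hts) p
  induction β using WellFoundedLT.induction with
  | ind β ih =>
    refine hW.restrictionMem_of_definable R hR fun s hs y => ?_
    constructor
    · rintro ⟨e, hAe, hTe⟩
      exact (hTval e s (fun t ht _ => hAval e s hAe t ht) y).1 hTe
    · intro hy
      obtain ⟨e, heW, he⟩ := ih s hs
      have he' : ∀ t < s, ∀ p : W,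
          ZFSet.pair t.toZFSet p ∈ e ↔ (p : ZFSet.{u}) = (collapse S t).toZFSet := fun t ht p => by
        rw [pair_toZFSet_mem_graph_iff he, and_iff_right ht]
      -- The collapse restricted to `s` is in `W` by induction, and witnesses `R` at `s`.
      refine ⟨⟨e, heW⟩, ?_, (hTval ⟨e, heW⟩ s (fun t ht _ => he' t ht) y).2 hy⟩
      rintro ⟨t, htW⟩ hts o
      obtain ⟨t, ht, rfl⟩ := Ordinal.mem_toZFSet_iff.1 hts
      rw [hTval ⟨e, heW⟩ t (fun t' ht' _ => he' t' (ht'.trans ht))]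
      exact he' t ht o

/-! ### Bijections in an inner model between a regular cardinal and larger ordinals -/

section Regular

variable {κ : Ordinal.{u}} (hW : IsInnerModel W) (hκ : IsRegularIn W κ)
include hW hκ

/-- If `W` has no cardinal in `(κ, μ)`, then every ordinal in `[κ, μ)` is in bijection with `κ`
in `W`. -/
theorem exists_bijOn_of_isRegularIn {μ : Ordinal.{u}}
    (hμ : ∀ β, κ < β → β < μ → ¬ IsCardinalIn W β) (β : Ordinal.{u}) (hκβ : κ ≤ β) (hβμ : β < μ) :
    ∃ F : Ordinal.{u} → Ordinal.{u}, RestrictionMem W κ F ∧ Set.BijOn F (Set.Iio κ) (Set.Iio β) := by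
  induction β using WellFoundedLT.induction with
  | ind β ih =>
    rcases hκβ.eq_or_lt with rfl | hlt
    · exact ⟨id, hW.restrictionMem_id _, Set.bijOn_id _⟩
    have h := hμ β hlt hβμ
    simp only [IsCardinalIn, not_forall, not_not] at h
    obtain ⟨α, hα, f, hfW, hf⟩ := h
    obtain ⟨F, hF, hFbij⟩ := hf.exists_bijOn hfW
    rcases lt_or_ge α κ with hακ | hακ
    · -- `F` maps `α < κ` onto `β > κ`; truncated at `κ` it is cofinal in `κ`.
      exfalso
      have hcomp := hW.restrictionMem_comp hF (hW.restrictionMem_id κ)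
      have hpos : 0 < κ := Ordinal.omega0_pos.trans_le hκ.1
      obtain ⟨δ, hδ, hb⟩ := hκ.exists_bound hακ hcomp (by
        intro ξ _
        split_ifs with h
        exacts [h, hpos])
      obtain ⟨ξ, hξ, hξδ⟩ := hFbij.surjOn (hδ.trans hlt : δ ∈ Set.Iio β)
      have := hb ξ hξ
      simp [hξδ, hδ] at this
    · obtain ⟨G, hG, hGbij⟩ := ih α hα hακ (hα.trans hβμ)
      refine ⟨F ∘ G, (hW.restrictionMem_comp hG hF).congr fun ξ hξ => ?_, hFbij.comp hGbij⟩
      exact if_pos (hGbij.mapsTo hξ)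

/-- Coherence: if `F` and `F'` in `W` are defined on `κ` and `F'` is a bijection onto `β'`, then the
image under `F` of an ordinal below `κ` meets `β'` within the image under `F'` of an ordinal
below `κ`. -/
theorem exists_image_subset_image {β' ν : Ordinal.{u}} {F F' : Ordinal.{u} → Ordinal.{u}}
    (hF : RestrictionMem W κ F) (hF' : RestrictionMem W κ F')
    (hbij' : Set.BijOn F' (Set.Iio κ) (Set.Iio β')) (hν : ν < κ) :
    ∃ ν' < κ, F '' Set.Iio ν ∩ Set.Iio β' ⊆ F' '' Set.Iio ν' := by
  have hcomp := hW.restrictionMem_comp hF (hW.restrictionMem_invFunOn hF' hbij')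
  have hpos : 0 < κ := Ordinal.omega0_pos.trans_le hκ.1
  -- `ξ ↦ F'⁻¹ (F ξ)` on `ν`, truncated at `β'`.
  have hrestr := hW.restrictionMem_comp (hW.restrictionMem_id ν) hcomp
  obtain ⟨δ, hδ, hb⟩ := hκ.exists_bound hν hrestr (by
    intro ξ hξ
    simp only [id]
    split_ifs with _ h
    exacts [Function.invFunOn_mem (hbij'.surjOn h), hpos, hpos])
  refine ⟨δ, hδ, ?_⟩
  rintro _ ⟨⟨ξ, hξ, rfl⟩, hlt⟩
  refine ⟨Function.invFunOn F' (Set.Iio κ) (F ξ), ?_, Function.invFunOn_eq (hbij'.surjOn hlt)⟩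
  have := hb ξ hξ
  simp only [id, if_pos ((hξ : ξ < ν).trans hν)] at this
  rwa [if_pos (show F ξ < β' from hlt)] at this

/-- The image under a function in `W` of an ordinal below `κ` has order type less than `κ`. -/
theorem not_strictMonoOn_of_mem_image {ν : Ordinal.{u}} {F h : Ordinal.{u} → Ordinal.{u}}
    (hF : RestrictionMem W κ F) (hν : ν < κ) (hmono : StrictMonoOn h (Set.Iio κ)) :
    ¬ ∀ δ < κ, h δ ∈ F '' Set.Iio ν := by
  intro hmem
  have hpos : 0 < κ := Ordinal.omega0_pos.trans_le hκ.1
  have hFν : RestrictionMem W ν F :=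
    (hW.restrictionMem_comp (hW.restrictionMem_id ν) hF).congr fun ξ hξ => if_pos (hξ.trans hν)
  obtain ⟨β, hβ⟩ := Ordinal.bddAbove_of_small (s := F '' Set.Iio ν)
  have hcol := hW.restrictionMem_collapse hFν (Order.succ β)
  -- `ξ ↦ collapse (F ξ)` on `ν`, truncated at `κ`: every ordinal below `κ` is a value.
  have hrestr := hW.restrictionMem_comp (hW.restrictionMem_comp hFν hcol) (hW.restrictionMem_id κ)
  obtain ⟨δ, hδ, hb⟩ := hκ.exists_bound hν hrestr (by
    intro ξ hξ
    split_ifs <;> assumption)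
  have hval : ∃ ξ < ν, collapse (F '' Set.Iio ν) (F ξ) = δ := by
    rcases (le_collapse_of_strictMonoOn hmono hmem δ hδ).eq_or_lt with heq | hlt
    · obtain ⟨ξ, hξ, hξδ⟩ := hmem δ hδ
      exact ⟨ξ, hξ, by rw [hξδ, ← heq]⟩
    · obtain ⟨_, ⟨ξ, hξ, rfl⟩, -, h⟩ := lt_collapse_iff.1 hlt
      exact ⟨ξ, hξ, h⟩
  obtain ⟨ξ, hξ, hξδ⟩ := hval
  have := hb ξ hξ
  rw [if_pos (Order.lt_succ_iff.2 (hβ ⟨ξ, hξ, rfl⟩)), hξδ] at this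
  simp [hδ] at this

/-- A regular cardinal of `W` is a limit ordinal: the predecessor `γ` of a successor ordinal would be
the value of a cofinal function with domain `1`. -/
theorem IsRegularIn.isSuccLimit : Order.IsSuccLimit κ := by
  have hpos : 0 < κ := Ordinal.omega0_pos.trans_le hκ.1
  refine Ordinal.isSuccLimit_iff.2 ⟨hpos.ne', ?_⟩
  by_contra h
  obtain ⟨γ, hγ⟩ := Order.not_isSuccPrelimit_iff_mem_range_succ.1 h
  obtain ⟨δ, hδ, hb⟩ := hκ.exists_bound (Ordinal.one_lt_omega0.trans_le hκ.1)
    (hW.restrictionMem_const 1 γ) (fun _ _ => by rw [← hγ]; exact Order.lt_succ γ)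
  rw [← hγ, Order.lt_succ_iff] at hδ
  exact (hb 0 zero_lt_one).not_ge hδ

end Regular

end InnerModel

/-! ### The covering property under strong compactness -/

/-- A subset of a regular cardinal `ν` with fewer than `ν` elements has a strict upper bound. -/
theorem exists_forall_lt_of_mk_lt {ν : Cardinal.{u}} (hν : ν.IsRegular) {X : Set ν.ord.ToType}
    (hX : #X < ν) : ∃ γ, ∀ x ∈ X, x < γ := by
  by_contra! h
  have := Order.cof_le (s := X) h
  rw [Ordinal.cof_toType, hν.cof_ord] at this
  exact this.not_gt hX

/-- A strongly compact cardinal `μ` implies `CP(ν, θ)` for `θ < μ ≤ ν` with `ν` regular. -/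
theorem IsStronglyCompact.CP {μ ν θ : Cardinal.{u}} (hμ : IsStronglyCompact μ) (hν : ν.IsRegular)
    (hμν : μ ≤ ν) (hθμ : θ < μ) : CP ν θ := by
  intro K hK
  obtain ⟨hω, hU⟩ := hμ
  obtain ⟨U, hUμ, hfine⟩ := hU ν hμν
  -- `b Y` is a strict upper bound of `Y`.
  choose b hb using fun Y : {Y : Set ν.ord.ToType // #Y < μ} =>
    exists_forall_lt_of_mk_lt hν (Y.2.trans_le hμν)
  have hθ : #θ.ord.ToType < μ := by rwa [mk_ord_toType]
  -- By completeness, one index `a γ` works for `U`-almost all `Y`.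
  have ha : ∀ γ, ∃ α, {Y | γ ∈ K α (b Y)} ∈ U := by
    intro γ
    by_contra! h
    have h1 : (⋂ α, {Y | γ ∈ K α (b Y)}ᶜ) ∈ (U : Filter _) :=
      (Filter.cardinal_iInter_mem hθ).2 fun α => Ultrafilter.compl_mem_iff_notMem.2 (h α)
    have h2 := hfine {γ} (by simpa using one_lt_aleph0.trans hω)
    obtain ⟨Y, hY1, hY2⟩ := U.nonempty_of_mem (Filter.inter_mem h1 h2)
    obtain ⟨α, hα⟩ := Set.mem_iUnion.1 (hK.covers (b Y) (hb Y γ (hY2 rfl)))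
    exact Set.mem_iInter.1 hY1 α hα
  choose a ha using ha
  have hcof : ∃ α, IsCofinal {γ | a γ = α} := by
    refine isCofinal_of_isCofinal_iUnion (s := fun α => {γ | a γ = α}) ?_ ?_
    · intro γ
      exact ⟨γ, Set.mem_iUnion.2 ⟨_, rfl⟩, le_rfl⟩
    · rw [Ordinal.cof_toType, hν.cof_ord]
      exact hθ.trans_le hμν
  obtain ⟨α, hα⟩ := hcof
  refine ⟨_, hα, fun X hX hXθ => ?_⟩
  have h : (⋂ γ : X, {Y | (γ : ν.ord.ToType) ∈ K α (b Y)}) ∈ (U : Filter _) :=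
    (Filter.cardinal_iInter_mem (by rwa [hXθ])).2 fun γ => by
      have := ha γ
      rwa [show a γ = α from hX γ.2] at this
  obtain ⟨Y, hY⟩ := U.nonempty_of_mem h
  exact ⟨α, b Y, fun γ hγ => Set.mem_iInter.1 hY ⟨γ, hγ⟩⟩

/-! ### The covering property and the cofinality of a regular cardinal of an inner model -/

/-- An ordinal has a strictly increasing cofinal sequence of length its cofinality. -/
theorem exists_strictMono_cofinal (κ : Ordinal.{u}) :
    ∃ g : κ.cof.ord.ToType → Ordinal.{u}, StrictMono g ∧ (∀ α, g α < κ) ∧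
      ∀ δ < κ, ∃ α, δ ≤ g α := by
  obtain ⟨s, hs, hst⟩ := Ordinal.exists_ord_cof_eq κ.ToType
  rw [Ordinal.cof_toType, ← Ordinal.type_toType κ.cof.ord, eq_comm] at hst
  obtain ⟨e⟩ := Ordinal.type_eq.1 hst
  refine ⟨fun α => ((e α : κ.ToType) : Ordinal.{u}), fun α η h => ?_, fun α => ?_, fun δ hδ => ?_⟩
  · have h' : (e α : κ.ToType) < e η := e.map_rel_iff.2 h
    exact Ordinal.ToType.mk.symm.strictMono h'
  · exact (e α : κ.ToType).toOrd.2
  · obtain ⟨y, hy, hle⟩ := hs (Ordinal.ToType.mk ⟨δ, hδ⟩)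
    refine ⟨e.symm ⟨y, hy⟩, ?_⟩
    dsimp only
    rw [e.apply_symm_apply]
    exact (Ordinal.ToType.mk.le_symm_apply).2 hle

/-- `CP(κ⁺, θ)` fails if `κ` has cofinality `θ`, is regular in `W`, and `W` computes `κ⁺`
correctly. -/
theorem IsRegularIn.cof_ne_of_CP {W : Set ZFSet.{u}} {κ : Ordinal.{u}} (hκ : IsRegularIn W κ)
    (hW : IsInnerModel W) (hsucc : IsSuccCardinalIn W κ (Order.succ κ.card).ord)
    {θ : Cardinal.{u}} (hθ : θ.IsRegular) (hθκ : θ < Order.succ κ.card)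
    (hCP : CP (Order.succ κ.card) θ) : κ.cof ≠ θ := by
  rintro rfl
  obtain ⟨g, hgmono, hgκ, hg⟩ := exists_strictMono_cofinal κ
  have hκω : ℵ₀ ≤ κ.card := Ordinal.aleph0_le_card.2 hκ.1
  have hreg : (Order.succ κ.card).IsRegular := isRegular_succ hκω
  set μ := Order.succ κ.card with hμ
  have hκμ : κ < μ.ord := hsucc.1.1
  have hadd : ∀ β : μ.ord.ToType, κ + (β : Ordinal.{u}) < μ.ord := fun β =>
    isPrincipal_add_ord hreg.aleph0_le hκμ β.toOrd.2
  -- `f β` is a bijection in `W` from `κ` onto `κ + β`.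
  choose f hfW hf using fun β : μ.ord.ToType => exists_bijOn_of_isRegularIn hW hκ
    (μ := μ.ord) (fun β hκβ hβ hcard => (hsucc.2 ⟨hκβ, hcard⟩).not_gt hβ) (κ + β) le_self_add (hadd β)
  let K : κ.cof.ord.ToType → μ.ord.ToType → Set μ.ord.ToType :=
    fun α β => {x | (x : Ordinal.{u}) ∈ f β '' Set.Iio (g α)}
  -- This yields both coherence conditions, and the passage from `K α β'` to `K η β` below.
  have hcoh : ∀ (β γ : μ.ord.ToType) (α : κ.cof.ord.ToType), ∃ η, ∀ x ∈ K α β, (x : Ordinal.{u}) < κ + γ → x ∈ K η γ := by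
    intro β γ α
    obtain ⟨δ, hδ, hsub⟩ := exists_image_subset_image hW hκ (hfW β) (hfW γ) (hf γ) (hgκ α)
    obtain ⟨η, hη⟩ := hg δ hδ
    exact ⟨η, fun x hx hxγ => Set.image_mono (Set.Iio_subset_Iio hη) (hsub ⟨hx, hxγ⟩)⟩
  have hlt : ∀ {x γ : μ.ord.ToType}, x < γ → (x : Ordinal.{u}) < κ + γ := fun h =>
    lt_of_lt_of_le (Ordinal.ToType.mk.symm.strictMono h) le_add_self
  have hbound : ∀ {β x α}, x ∈ K α β → (x : Ordinal.{u}) < κ + β := by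
    rintro β x α ⟨ξ, hξ, hx⟩
    rw [← hx]
    exact (hf β).mapsTo ((hξ : ξ < g α).trans (hgκ α))
  have hK : IsCoveringMatrix μ κ.cof K := by
    refine ⟨fun β x hx => ?_, fun α β => ?_, fun β α η hαη => ?_, fun γ β hγβ α => ?_,
      fun X hX => ?_⟩
    · obtain ⟨ξ, hξ, hx⟩ := (hf β).surjOn (Set.mem_Iio.2 (hlt hx))
      obtain ⟨α, hα⟩ := hg (Order.succ ξ) ((hκ.isSuccLimit hW).succ_lt hξ)
      exact Set.mem_iUnion.2 ⟨α, ξ, (Order.lt_succ ξ).trans_le hα, hx⟩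
    · have hsub : K α β ⊆ Set.Iio (Ordinal.ToType.mk ⟨κ + β, hadd β⟩) := fun x hx =>
        Ordinal.ToType.mk.symm_apply_lt.1 (Subtype.coe_lt_coe.1 (hbound hx))
      exact (mk_le_mk_of_subset hsub).trans_lt ((mk_Iio_lt _ (by simp)).trans_eq (mk_ord_toType μ))
    · exact fun x hx => Set.image_mono (Set.Iio_subset_Iio (hgmono hαη).le) hx
    · obtain ⟨η, hη⟩ := hcoh γ β α
      refine ⟨η, fun x hx => hη x hx ((hbound hx).trans ?_)⟩
      have h : (γ : Ordinal.{u}) < β := Ordinal.ToType.mk.symm.strictMono hγβ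
      gcongr
    -- Local coherence: any strict upper bound `γ` of `X` works.
    · obtain ⟨γ, hγ⟩ := exists_forall_lt_of_mk_lt hreg (hX.trans_lt hθκ)
      refine ⟨γ, fun β η => ?_⟩
      obtain ⟨α, hα⟩ := hcoh β γ η
      exact ⟨α, fun x hx => hα x hx.1 (hlt (hγ x hx.2))⟩
  obtain ⟨A, hA, hAK⟩ := hCP K hK
  have : IsRegularCardinalOrder μ.ord.ToType :=
    ⟨by rw [Ordinal.type_toType, Ordinal.cof_toType, hreg.cof_ord]⟩
  -- `T δ` is the `δ`-th element of `A`.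
  let T : Set.Iio μ.ord → μ.ord.ToType := fun δ => Order.enum A hA (Ordinal.ToType.mk δ)
  have hTmono : StrictMono T := fun δ ε h =>
    (Order.enum A hA).strictMono (Ordinal.ToType.mk.strictMono h)
  have hTA : ∀ δ, T δ ∈ A := fun δ => (Order.enum A hA (Ordinal.ToType.mk δ)).2
  let β := T ⟨κ, hκμ⟩
  -- The first `κ` elements of `A` lie in a single `K α β`: otherwise `κ.cof` many witnesses, one
  -- for each `α`, lie in some `K α' β'`, hence in some `K η β`.
  have hcover : ∃ α, ∀ δ (hδ : δ < κ), T ⟨δ, hδ.trans hκμ⟩ ∈ K α β := by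
    by_contra! h
    choose d hdκ hd using h
    let X' : Set μ.ord.ToType := Set.range fun α => T ⟨d α, (hdκ α).trans hκμ⟩
    have hX' : #X' ≤ κ.cof := mk_range_le.trans_eq (mk_ord_toType _)
    have hAcard : κ.cof ≤ #A := by
      have := Order.cof_le hA
      rw [Ordinal.cof_toType, hreg.cof_ord] at this
      exact hθκ.le.trans this
    obtain ⟨Y, hYA, hY⟩ := le_mk_iff_exists_subset.1 hAcard
    have hXA : X' ∪ Y ⊆ A := by
      rintro x (⟨α, rfl⟩ | hx)
      exacts [hTA _, hYA hx]
    obtain ⟨α, β', hX⟩ := hAK (X' ∪ Y) hXA (le_antisymm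
      ((mk_union_le _ _).trans (by
        rw [hY]
        exact (add_le_add_left hX' _).trans_eq (add_eq_self hθ.aleph0_le)))
      (hY ▸ mk_le_mk_of_subset Set.subset_union_right))
    obtain ⟨η, hη⟩ := hcoh β' β α
    exact hd η (hη _ (hX (.inl ⟨η, rfl⟩)) (hlt (hTmono (hdκ η))))
  obtain ⟨α, hα⟩ := hcover
  refine not_strictMonoOn_of_mem_image hW hκ (hfW β) (hgκ α)
    (h := fun δ => if hδ : δ < κ then (T ⟨δ, hδ.trans hκμ⟩ : Ordinal.{u}) else 0) ?_ ?_
  · intro δ hδ ε hε h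
    simp only [dif_pos (show δ < κ from hδ), dif_pos (show ε < κ from hε)]
    exact Ordinal.ToType.mk.symm.strictMono (hTmono h)
  · intro δ hδ
    simp only [dif_pos hδ]
    exact hα δ hδ

/-- The universe `V` is Mathlib's `ZFSet.{u}`, with its ordinals `Ordinal.{u}` and cardinals
`Cardinal.{u}`. The ordinal `κ` need not be a cardinal of `V`; in `V` its cardinal successor `κ⁺` is
the successor of the cardinality of `κ`. -/
theorem mainTheorem8 (W : Set ZFSet.{u}) (hW : IsInnerModel W) (κ : Ordinal.{u})
    (hκ : IsRegularIn W κ) (hsucc : IsSuccCardinalIn W κ (Order.succ κ.card).ord) :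
    (∀ θ : Cardinal.{u}, θ.IsRegular → θ < Order.succ κ.card → CP (Order.succ κ.card) θ →
      κ.cof ≠ θ) ∧
    (∀ μ : Cardinal.{u}, IsStronglyCompact μ → μ.ord ≤ κ →
      ∀ θ : Cardinal.{u}, θ < μ → κ.cof ≠ θ) := by
  refine ⟨fun θ hθ hθκ hCP => hκ.cof_ne_of_CP hW hsucc hθ hθκ hCP, ?_⟩
  rintro μ hμ hμκ _ hθμ rfl
  have hle : μ ≤ Order.succ κ.card := (ord_le.1 hμκ).trans (Order.le_succ _)
  exact hκ.cof_ne_of_CP hW hsucc (isRegular_cof (hκ.isSuccLimit hW)) (hθμ.trans_le hle)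
    (hμ.CP (isRegular_succ (Ordinal.aleph0_le_card.2 hκ.1)) hle hθμ) rfl
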